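/- Let $\Bbbk$ be an algebraically closed field of characteristic $p>0$, let $d\ge 0$, and let $G\subseteq \mathrm{GL}(d,\Bbbk)$ be a finite cyclic subgroup of order $n$ with $p\nmid n$. Assume that $G$ is small, i.e. no element of $G$ has a space of fixed vectors of dimension exactly $d-1$. Let $\lambda\in\Bbbk$ be a primitive $n$-th root of unity and let $t_1,\dots,t_d$ be non-negative integers such that, in suitable linear coordinates, $G$ is generated by $\mathrm{diag}(\lambda^{t_1},\dots,\lambda^{t_d})$. Let $G$ act on $S=\Bbbk[[x_1,\dots,x_d]]$ by linear substitutions of the variables, let $R=S^G$, and let $FS(e)$ be the F-signature function of $R$, i.e. the maximal rank of a free $R$-module onto which $R^{1/p^e}$ surjects ($e\in\mathbb N$). For $J\subseteq\{1,\dots,d\}$ let $g_J=\gcd(\{t_j: j\in J\}\cup\{n\})$ (so $g_\emptyset=n$). For $e\in\mathbb N$ let $r_e$ be the remainder of $p^e$ modulo $n$, let $\theta_J(e)$ be the number of families $(a_l)_{l\notin J}$ of integers with $0\le a_l\le r_e-1$ and $\sum_{l\notin J}a_lt_l\equiv 0 \pmod{g_J}$ (so $\theta_{\{1,\dots,d\}}(e)=1$),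 and for $0\le i\le d$ let $\psi_i(e)=\sum_{|J|=i}g_J\,\theta_J(e)$. Then there are unique periodic functions $\varphi_0,\dots,\varphi_d:\mathbb N\to\mathbb Q$ such that $FS(e)=\sum_{c=0}^d\varphi_c(e)\,p^{ce}$ for all $e\in\mathbb N$, and they have the following properties. 1. For every integer $c$ with $1\le c\le d-1$: the functions $\varphi_{d-1},\dots,\varphi_c$ are all identically zero if and only if $g_J=1$ for every $J$ with $|J|=c$. 2. If $0\le \ell<d$, the functions $\varphi_{d-1},\dots,\varphi_{\ell+1}$ are identically zero and $\varphi_\ell$ is not identically zero, then for all $e\in\mathbb N$ $$\varphi_\ell(e)=\frac{\psi_\ell(e)-\binom d\ell\, r_e^{\,d-\ell}}{n}.$$ -/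

import Mathlib

open scoped MatrixGroups

namespace CyclicQuotient

noncomputable section

/-! ### The F-signature function of a ring of characteristic `p` -/

/-- The `R`-module `R^{1/p^e}`, realised as the additive group of `R` on which `r` acts as
multiplication by `r ^ (p ^ e)`. (For reduced `R` the map `x ↦ x^{1/p^e}` identifies it with the
overring of `p^e`-th roots.) -/
def FrobeniusRoot (R : Type*) (_p _e : ℕ) : Type _ := R

instance (R : Type*) [CommRing R] (p e : ℕ) : AddCommGroup (FrobeniusRoot R p e) :=
  inferInstanceAs (AddCommGroup R)

instance (R : Type*) [CommRing R] (p e : ℕ) [ExpChar R p] : Module R (FrobeniusRoot R p e) :=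
  Module.compHom R (iterateFrobenius R p e)

/-- The free rank of an `R`-module: the maximal rank of a finite free module onto which `M`
surjects. For a finitely generated module over a nontrivial commutative ring the set is nonempty
and bounded, so this is a genuine maximum. -/
def freeRank (R M : Type*) [CommRing R] [AddCommGroup M] [Module R M] : ℕ :=
  sSup {m : ℕ | ∃ f : M →ₗ[R] (Fin m → R), Function.Surjective f}

/-- The F-signature function `e ↦ frk_R (R^{1/p^e})`. -/
def FS (R : Type*) [CommRing R] (p : ℕ) [ExpChar R p] (e : ℕ) : ℕ :=
  freeRank R (FrobeniusRoot R p e)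

/-- `φ 0, …, φ d` are the coefficients of `F` as a quasi-polynomial of degree at most `d` in
`p ^ e`: each of them is a (purely) periodic, hence bounded, rational-valued function of `e`, and
`F e = ∑ c, φ c e * p ^ (c * e)` for all `e`. -/
structure IsQuasiPolynomial (F : ℕ → ℕ) (p d : ℕ) (φ : Fin (d + 1) → ℕ → ℚ) : Prop where
  periodic : ∀ c, ∃ N : ℕ, 0 < N ∧ Function.Periodic (φ c) N
  expansion : ∀ e : ℕ, (F e : ℚ) = ∑ c : Fin (d + 1), φ c e * (p : ℚ) ^ ((c : ℕ) * e)

/-! ### Linear group actions on power series, and quotient singularities -/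

variable {k : Type*} [Field k] {d : ℕ}

theorem hasSubst_linear (A : Matrix (Fin d) (Fin d) k) :
    MvPowerSeries.HasSubst
      (fun j : Fin d => ∑ i, A i j • (MvPowerSeries.X i : MvPowerSeries (Fin d) k)) :=
  MvPowerSeries.hasSubst_of_constantCoeff_zero (fun j => by simp)

/-- The linear action of a matrix `A` on `k⟦x_1, …, x_d⟧`: the substitution
`x_j ↦ ∑ i, A i j • x_i`. -/
def linearAction (A : Matrix (Fin d) (Fin d) k) :
    MvPowerSeries (Fin d) k →ₐ[k] MvPowerSeries (Fin d) k :=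
  MvPowerSeries.substAlgHom (hasSubst_linear A)

/-- The ring of invariants `k⟦x_1, …, x_d⟧ ^ G`. -/
def invariants (G : Subgroup (GL (Fin d) k)) : Subalgebra k (MvPowerSeries (Fin d) k) :=
  ⨅ g ∈ G, AlgHom.equalizer (linearAction (g : Matrix (Fin d) (Fin d) k)) (AlgHom.id k _)

instance (p : ℕ) [ExpChar k p] (G : Subgroup (GL (Fin d) k)) : ExpChar (invariants G) p :=
  expChar_of_injective_algebraMap (algebraMap k (invariants G)).injective p

/-- A pseudoreflection: the subspace of fixed vectors has dimension `d - 1`. -/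
def IsPseudoreflection (g : GL (Fin d) k) : Prop :=
  Module.finrank k (LinearMap.ker
    (Matrix.mulVecLin ((g : Matrix (Fin d) (Fin d) k) - 1))) + 1 = d

/-- A group is small if it contains no pseudoreflections. -/
def IsSmall (G : Subgroup (GL (Fin d) k)) : Prop :=
  ∀ g ∈ G, ¬ IsPseudoreflection g

/-- `G` is generated by one element, which in suitable linear coordinates is the diagonal matrix
`diag(ζ ^ t_1, …, ζ ^ t_d)`. -/
def IsCyclicOfType (G : Subgroup (GL (Fin d) k)) (ζ : k) (t : Fin d → ℕ) : Prop :=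
  ∃ g P : GL (Fin d) k, G = Subgroup.zpowers g ∧
    ((P * g * P⁻¹ : GL (Fin d) k) : Matrix (Fin d) (Fin d) k) =
      Matrix.diagonal (fun i => ζ ^ t i)

/-! ### The arithmetic functions `g_J`, `θ_J`, `ψ_i` -/

/-- `g_J`, the greatest common divisor of `n` and the `t_j` with `j ∈ J`; so `g_∅ = n`. -/
def gJ (n : ℕ) (t : Fin d → ℕ) (J : Finset (Fin d)) : ℕ :=
  Nat.gcd (J.gcd t) n

/-- `θ_J` as a function of the remainder `r`: the number of families `(a_l)`, `l ∉ J`, of integers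
`0 ≤ a_l ≤ r - 1` with `∑ l ∉ J, a_l * t_l ≡ 0` modulo `g_J`. -/
def theta (n : ℕ) (t : Fin d → ℕ) (r : ℕ) (J : Finset (Fin d)) : ℕ :=
  Nat.card {a : {l : Fin d // l ∉ J} → Fin r //
    ∑ l, (a l : ℕ) * t l ≡ 0 [MOD gJ n t J]}

/-- `ψ_i`, the sum of `g_J * θ_J` over the subsets `J` with `i` elements. -/
def psi (n : ℕ) (t : Fin d → ℕ) (r i : ℕ) : ℕ :=
  ∑ J ∈ Finset.powersetCard i (Finset.univ : Finset (Fin d)), gJ n t J * theta n t r J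

end

end CyclicQuotient

/-! Write `q = p ^ e`. In eigencoordinates `R` is the ring of power series supported on the
exponents `u` with `n ∣ ∑ i, u i * t i` (`nonempty_invariants_equiv`), and smallness says that
leaving out any single `t i` the remaining ones still generate `ℤ / n` (`gJ_erase_eq_one`).

The F-signature function is `FS(e) = #{a ∈ [0, q) ^ d | n ∣ ∑ i, a i * t i}`
(`FS_weightSubalgebra`). Each such `a` gives a free summand of `R^{1/q}` spanned by `x ^ (a / q)`
(`exists_surjective_boxCount`). Conversely a linear map `R^{1/q} → R` sends every root of a series
without monomials in the box `[0, q) ^ d` into the maximal ideal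
(`constantCoeff_eq_zero_of_exists_le`). This is where smallness enters: it supplies a monomial of the
same weight as `x_i` that does not involve `x_i`, with which a division by `x_i ^ q` can be undone
without introducing a factor `x_i`. Since `k` is perfect, what is left of `R^{1/q}` modulo the
maximal ideal has as many dimensions as there are admissible points in the box
(`le_boxCount_of_surjective`).

The box is counted with characters of `ℤ / n`. Writing `q = n * (q / n) + r`, the sum
`∑ a < q, χ (a * t i)` is `n * (q / n)` or `0` according as `χ (t i) = 1` or not, plus the sum over
`a < r`. Expanding the product over `i` gives `n * FS(e) = ∑ i, ψ_i(e) * (q - r) ^ i`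
(`mul_boxCount`). The coefficients of this polynomial in `q` depend on `e` through `r` only, hence are
periodic, and periodic coefficients are unique (`IsQuasiPolynomial.unique`).

Finally, subtracting `q ^ d = ∑ i, (d.choose i) * r ^ (d - i) * (q - r) ^ i` replaces `ψ_i` by its
difference `psiDefect` from the value that it has when `g_J = 1` for all `J` with `i` elements. In
the powers of `q` and of `q - r` the same top coefficients vanish and the first nonzero ones agree
(`coeff_shiftedPolynomial`, `coeff_shiftedPolynomial_eq_zero_iff`), which is the second property. For
the first one, if `n > 1` then at `e = 0` all `θ_J` are `1`, and `∑ g_J = d.choose c` over `|J| = c`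
forces every `g_J` to be `1`. -/

/-! ### Diagonal coordinates and smallness -/

namespace CyclicQuotient

variable {k : Type*} [Field k] {d : ℕ}

theorem linearAction_mul_apply (A B : Matrix (Fin d) (Fin d) k) (f : MvPowerSeries (Fin d) k) :
    linearAction (A * B) f = linearAction A (linearAction B f) := by
  have h := MvPowerSeries.substAlgHom_comp_substAlgHom_apply (hasSubst_linear B)
    (hasSubst_linear A) f
  rw [linearAction, linearAction, linearAction, h]
  simp only [MvPowerSeries.substAlgHom_apply]
  congr 1
  funext j
  rw [← MvPowerSeries.substAlgHom_apply (hasSubst_linear A), map_sum]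
  simp_rw [map_smul, MvPowerSeries.substAlgHom_X, Finset.smul_sum, smul_smul]
  rw [Finset.sum_comm]
  simp_rw [Matrix.mul_apply, Finset.sum_smul, mul_comm]

theorem linearAction_diagonal (c : Fin d → k) (f : MvPowerSeries (Fin d) k) :
    linearAction (Matrix.diagonal c) f = MvPowerSeries.rescale c f := by
  rw [MvPowerSeries.rescale_eq_subst, linearAction, MvPowerSeries.substAlgHom_apply]
  congr 1
  funext j
  rw [Finset.sum_eq_single j]
  · simp
  · intro b _ hb
    simp [Matrix.diagonal_apply_ne _ hb]
  · simp

theorem linearAction_one_apply (f : MvPowerSeries (Fin d) k) :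
    linearAction (1 : Matrix (Fin d) (Fin d) k) f = f := by
  rw [← Matrix.diagonal_one, linearAction_diagonal]
  exact DFunLike.congr_fun (MvPowerSeries.rescale_one (σ := Fin d) (R := k)) f

theorem mem_invariants_iff (G : Subgroup (GL (Fin d) k)) (f : MvPowerSeries (Fin d) k) :
    f ∈ invariants G ↔ ∀ g ∈ G, linearAction (g : Matrix (Fin d) (Fin d) k) f = f := by
  simp [invariants, Algebra.mem_iInf, AlgHom.mem_equalizer]

theorem mem_invariants_zpowers_iff (g : GL (Fin d) k) (f : MvPowerSeries (Fin d) k) :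
    f ∈ invariants (Subgroup.zpowers g) ↔
      linearAction (g : Matrix (Fin d) (Fin d) k) f = f := by
  rw [mem_invariants_iff]
  refine ⟨fun h => h g (Subgroup.mem_zpowers g), fun h => ?_⟩
  let H : Subgroup (GL (Fin d) k) :=
    { carrier := {x | linearAction (x : Matrix (Fin d) (Fin d) k) f = f}
      mul_mem' := by
        intro a b ha hb
        simp only [Set.mem_ofPred_eq] at ha hb ⊢
        rw [Units.val_mul, linearAction_mul_apply, hb, ha]
      one_mem' := linearAction_one_apply f
      inv_mem' := by
        intro a ha
        simp only [Set.mem_ofPred_eq] at ha ⊢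
        conv_lhs => rw [← ha]
        rw [← linearAction_mul_apply, ← Units.val_mul, inv_mul_cancel, Units.val_one,
          linearAction_one_apply] }
  have hle : Subgroup.zpowers g ≤ H := by
    rw [Subgroup.zpowers_le]
    exact h
  exact fun x hx => hle hx

/-- The linear action of an invertible matrix as an automorphism of the power series ring. -/
noncomputable def linearActionEquiv (P : GL (Fin d) k) :
    MvPowerSeries (Fin d) k ≃ₐ[k] MvPowerSeries (Fin d) k :=
  AlgEquiv.ofAlgHom (linearAction (P : Matrix (Fin d) (Fin d) k))
    (linearAction ((P⁻¹ : GL (Fin d) k) : Matrix (Fin d) (Fin d) k))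
    (AlgHom.ext fun f => by
      rw [AlgHom.comp_apply, ← linearAction_mul_apply, ← Units.val_mul, mul_inv_cancel,
        Units.val_one, linearAction_one_apply, AlgHom.id_apply])
    (AlgHom.ext fun f => by
      rw [AlgHom.comp_apply, ← linearAction_mul_apply, ← Units.val_mul, inv_mul_cancel,
        Units.val_one, linearAction_one_apply, AlgHom.id_apply])

theorem linearActionEquiv_apply (P : GL (Fin d) k) (f : MvPowerSeries (Fin d) k) :
    linearActionEquiv P f = linearAction (P : Matrix (Fin d) (Fin d) k) f := rfl

/-- The power series all of whose monomials `x ^ u` satisfy `∑ i, u i * t i ≡ 0 mod n`, the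
completed monomial ring of the lattice `{u | n ∣ ∑ i, u i * t i}`. -/
def weightSubalgebra (k : Type*) [Field k] {d : ℕ} (n : ℕ) (t : Fin d → ℕ) :
    Subalgebra k (MvPowerSeries (Fin d) k) where
  carrier := {f | ∀ u, MvPowerSeries.coeff u f ≠ 0 → n ∣ Finsupp.weight t u}
  mul_mem' := by
    classical
    intro f g hf hg u hu
    rw [MvPowerSeries.coeff_mul] at hu
    obtain ⟨⟨a, b⟩, hab, h⟩ := Finset.exists_ne_zero_of_sum_ne_zero hu
    rw [← Finset.HasAntidiagonal.mem_antidiagonal.mp hab, map_add]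
    exact dvd_add (hf a (left_ne_zero_of_mul h)) (hg b (right_ne_zero_of_mul h))
  add_mem' := by
    intro f g hf hg u hu
    by_cases h : MvPowerSeries.coeff u f = 0
    · exact hg u (by simpa [h] using hu)
    · exact hf u h
  algebraMap_mem' := by
    classical
    intro c u hu
    rw [MvPowerSeries.algebraMap_apply, MvPowerSeries.coeff_C] at hu
    have : u = 0 := by
      by_contra h
      simp [h] at hu
    simp [this]

theorem mem_weightSubalgebra_iff {n : ℕ} {t : Fin d → ℕ} {f : MvPowerSeries (Fin d) k} :
    f ∈ weightSubalgebra k n t ↔ ∀ u, MvPowerSeries.coeff u f ≠ 0 → n ∣ Finsupp.weight t u :=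
  Iff.rfl

theorem weight_eq_sum (t : Fin d → ℕ) (u : Fin d →₀ ℕ) :
    Finsupp.weight t u = ∑ i, u i * t i := by
  rw [Finsupp.weight_apply, Finsupp.sum_fintype _ _ (by simp)]
  rfl

theorem linearAction_diagonal_eq_self_iff {n : ℕ} {ζ : k} (hζ : IsPrimitiveRoot ζ n)
    (t : Fin d → ℕ) (f : MvPowerSeries (Fin d) k) :
    linearAction (Matrix.diagonal fun i => ζ ^ t i) f = f ↔ f ∈ weightSubalgebra k n t := by
  rw [linearAction_diagonal, mem_weightSubalgebra_iff, MvPowerSeries.ext_iff]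
  refine forall_congr' fun u => ?_
  have h : (u.prod fun s m => (ζ ^ t s) ^ m) = ζ ^ Finsupp.weight t u := by
    rw [weight_eq_sum, Finsupp.prod_fintype _ _ (by simp), ← Finset.prod_pow_eq_pow_sum]
    exact Finset.prod_congr rfl fun i _ => by rw [← pow_mul, mul_comm]
  rw [MvPowerSeries.coeff_rescale, h, ← hζ.pow_eq_one_iff_dvd]
  constructor
  · intro h1 h2
    exact mul_right_cancel₀ h2 (by rw [h1, one_mul])
  · intro h1
    by_cases h2 : MvPowerSeries.coeff u f = 0
    · simp [h2]
    · rw [h1 h2, one_mul]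

theorem mem_invariants_iff_linearAction_mem {n : ℕ} {ζ : k} (hζ : IsPrimitiveRoot ζ n)
    (t : Fin d → ℕ) (g P : GL (Fin d) k)
    (hP : ((P * g * P⁻¹ : GL (Fin d) k) : Matrix (Fin d) (Fin d) k) =
      Matrix.diagonal (fun i => ζ ^ t i)) (f : MvPowerSeries (Fin d) k) :
    f ∈ invariants (Subgroup.zpowers g) ↔
      linearAction (P : Matrix (Fin d) (Fin d) k) f ∈ weightSubalgebra k n t := by
  rw [mem_invariants_zpowers_iff, ← linearAction_diagonal_eq_self_iff hζ, ← hP,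
    ← linearAction_mul_apply, ← Units.val_mul, inv_mul_cancel_right, Units.val_mul,
    linearAction_mul_apply]
  exact ((linearActionEquiv P).injective.eq_iff).symm

/-- A change to eigencoordinates identifies the invariant ring with a completed monomial ring. -/
theorem nonempty_invariants_equiv {n : ℕ} {ζ : k} (hζ : IsPrimitiveRoot ζ n)
    {t : Fin d → ℕ} {G : Subgroup (GL (Fin d) k)} (hG : IsCyclicOfType G ζ t) :
    Nonempty (invariants G ≃+* weightSubalgebra k n t) := by
  obtain ⟨g, P, rfl, hP⟩ := hG
  have hmem := mem_invariants_iff_linearAction_mem hζ t g P hP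
  have hmap : (invariants (Subgroup.zpowers g)).map (linearActionEquiv P : _ →ₐ[k] _) =
      weightSubalgebra k n t := by
    ext f
    rw [Subalgebra.mem_map]
    constructor
    · rintro ⟨x, hx, rfl⟩
      exact (hmem x).mp hx
    · intro hf
      refine ⟨(linearActionEquiv P).symm f, (hmem _).mpr ?_, (linearActionEquiv P).apply_symm_apply f⟩
      rw [← linearActionEquiv_apply, AlgEquiv.apply_symm_apply]
      exact hf
  exact ⟨(((linearActionEquiv P).subalgebraMap _).trans
    (Subalgebra.equivOfEq _ _ hmap)).toRingEquiv⟩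

theorem finrank_ker_sub_one [DecidableEq k] (h P : GL (Fin d) k) (w : Fin d → k)
    (hP : ((P * h * P⁻¹ : GL (Fin d) k) : Matrix (Fin d) (Fin d) k) = Matrix.diagonal w) :
    Module.finrank k (LinearMap.ker
      (Matrix.mulVecLin ((h : Matrix (Fin d) (Fin d) k) - 1))) +
        Fintype.card {i // w i - 1 ≠ 0} = d := by
  have h1 : (h : Matrix (Fin d) (Fin d) k) - 1 =
      ((P⁻¹ : GL (Fin d) k) : Matrix (Fin d) (Fin d) k) * Matrix.diagonal (fun i => w i - 1) *
        (P : Matrix (Fin d) (Fin d) k) := by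
    have : Matrix.diagonal (fun i => w i - 1) = Matrix.diagonal w - 1 := by
      rw [← Matrix.diagonal_one, Matrix.diagonal_sub]
    rw [this, ← hP, mul_sub, sub_mul, ← Units.val_mul, ← Units.val_mul, mul_one, ← Units.val_mul]
    simp [mul_assoc]
  have h2 : ((h : Matrix (Fin d) (Fin d) k) - 1).rank = Fintype.card {i // w i - 1 ≠ 0} := by
    rw [h1, Matrix.rank_mul_eq_left_of_isUnit_det _ _ ((Matrix.isUnit_iff_isUnit_det _).mp P.isUnit),
      Matrix.rank_mul_eq_right_of_isUnit_det _ _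
        ((Matrix.isUnit_iff_isUnit_det _).mp (P⁻¹).isUnit)]
    exact Matrix.rank_diagonal _
  rw [← h2, add_comm]
  have := LinearMap.finrank_range_add_finrank_ker
    (Matrix.mulVecLin ((h : Matrix (Fin d) (Fin d) k) - 1))
  rwa [Module.finrank_fin_fun] at this

/-- Smallness in arithmetic terms: were `g_J` larger than `1` for `J` the complement of a single
index, the power of the generator with exponent `n / g_J` would be a pseudoreflection. -/
theorem gJ_erase_eq_one {n : ℕ} (hn : 0 < n) {ζ : k} (hζ : IsPrimitiveRoot ζ n)
    {t : Fin d → ℕ} {G : Subgroup (GL (Fin d) k)} (hcard : Nat.card G = n) (hsmall : IsSmall G)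
    (hG : IsCyclicOfType G ζ t) (i : Fin d) : gJ n t (Finset.univ.erase i) = 1 := by
  classical
  obtain ⟨g, P, rfl, hP⟩ := hG
  rw [Nat.card_zpowers] at hcard
  obtain ⟨m, hm⟩ : gJ n t (Finset.univ.erase i) ∣ n := Nat.gcd_dvd_right _ _
  have hdvd : ∀ j ≠ i, n ∣ t j * m := by
    intro j hj
    have h1 : gJ n t (Finset.univ.erase i) ∣ t j :=
      (Nat.gcd_dvd_left _ _).trans (Finset.gcd_dvd (by simp [hj]))
    calc n = gJ n t (Finset.univ.erase i) * m := hm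
      _ ∣ t j * m := mul_dvd_mul_right h1 m
  have hPm : ((P * g ^ m * P⁻¹ : GL (Fin d) k) : Matrix (Fin d) (Fin d) k) =
      Matrix.diagonal (fun i => ζ ^ (t i * m)) := by
    rw [← conj_pow, Units.val_pow_eq_pow_val, hP, Matrix.diagonal_pow]
    congr 1
    funext i
    simp [pow_mul]
  by_cases hi : n ∣ t i * m
  · have hone : g ^ m = 1 := by
      have h1 : P * g ^ m * P⁻¹ = 1 := by
        apply Units.ext
        rw [hPm, Units.val_one, ← Matrix.diagonal_one]
        congr 1
        funext j
        rw [hζ.pow_eq_one_iff_dvd]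
        by_cases hj : j = i
        · exact hj ▸ hi
        · exact hdvd j hj
      exact conj_eq_one_iff.mp h1
    have h2 : n ∣ m := hcard ▸ orderOf_dvd_of_pow_eq_one hone
    have hm0 : 0 < m := Nat.pos_of_ne_zero fun h => by simp [h] at hm; omega
    have h3 : m = n := Nat.dvd_antisymm ⟨_, by rw [mul_comm]; exact hm⟩ h2
    rw [h3] at hm
    exact Nat.eq_of_mul_eq_mul_right hn (by rw [← hm, one_mul])
  · exfalso
    refine hsmall (g ^ m) (Subgroup.pow_mem _ (Subgroup.mem_zpowers g) m) ?_
    have h1 := finrank_ker_sub_one (g ^ m) P _ hPm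
    have h2 : Fintype.card {j // ζ ^ (t j * m) - 1 ≠ 0} = 1 := by
      rw [Fintype.card_eq_one_iff]
      refine ⟨⟨i, ?_⟩, ?_⟩
      · rwa [sub_ne_zero, Ne, hζ.pow_eq_one_iff_dvd]
      · rintro ⟨j, hj⟩
        rw [sub_ne_zero, Ne, hζ.pow_eq_one_iff_dvd] at hj
        by_contra hne
        exact hj (hdvd j fun h => hne (Subtype.ext h))
    rw [h2] at h1
    exact h1

end CyclicQuotient

/-! ### Counting solutions of a congruence in a box -/

namespace CyclicQuotient

variable {d : ℕ}

theorem sum_range_pow_rootOfUnity {n : ℕ} {ω : ℂ} (hω : IsPrimitiveRoot ω n) (s : ℕ) :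
    ∑ m ∈ Finset.range n, ω ^ (m * s) = if n ∣ s then (n : ℂ) else 0 := by
  have h : ∀ m, ω ^ (m * s) = (ω ^ s) ^ m := fun m => by rw [← pow_mul, mul_comm]
  simp_rw [h]
  split_ifs with hs
  · simp [(hω.pow_eq_one_iff_dvd s).mpr hs]
  · have h1 : ω ^ s ≠ 1 := fun h1 => hs ((hω.pow_eq_one_iff_dvd s).mp h1)
    rw [geom_sum_eq h1, ← pow_mul, mul_comm, pow_mul, hω.pow_eq_one, one_pow, sub_self, zero_div]

/-- Orthogonality of characters of `ℤ / n` counts the solutions of a linear congruence in a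
box. -/
theorem mul_card_congruence_eq_sum {ι : Type*} [Fintype ι] {n : ℕ} {ω : ℂ}
    (hω : IsPrimitiveRoot ω n) (t : ι → ℕ) (q : ℕ) :
    (n : ℂ) * (Nat.card {a : ι → Fin q // n ∣ ∑ i, (a i : ℕ) * t i} : ℂ) =
      ∑ m ∈ Finset.range n, ∏ i, ∑ a ∈ Finset.range q, ω ^ (m * (a * t i)) := by
  classical
  have h : ∀ m, ∏ i, ∑ a ∈ Finset.range q, ω ^ (m * (a * t i)) =
      ∑ a : ι → Fin q, ω ^ (m * ∑ i, (a i : ℕ) * t i) := by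
    intro m
    simp_rw [← Fin.sum_univ_eq_sum_range (fun a => ω ^ (m * (a * t _))) q]
    rw [Finset.prod_univ_sum, Fintype.piFinset_univ]
    refine Finset.sum_congr rfl fun a _ => ?_
    rw [Finset.mul_sum, Finset.prod_pow_eq_pow_sum]
  simp_rw [h]
  rw [Finset.sum_comm]
  simp_rw [sum_range_pow_rootOfUnity hω]
  rw [← Finset.sum_filter, Finset.sum_const, nsmul_eq_mul, mul_comm, Nat.card_eq_fintype_card,
    Fintype.card_subtype]

theorem sum_range_pow_split {n : ℕ} {ω : ℂ} (hω : IsPrimitiveRoot ω n) (q s : ℕ) :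
    ∑ a ∈ Finset.range q, ω ^ (a * s) =
      (if n ∣ s then ((n * (q / n) : ℕ) : ℂ) else 0) +
        ∑ a ∈ Finset.range (q % n), ω ^ (a * s) := by
  have hblock : ∀ k r : ℕ, ∑ a ∈ Finset.range (n * k + r), ω ^ (a * s) =
      (if n ∣ s then ((n * k : ℕ) : ℂ) else 0) + ∑ a ∈ Finset.range r, ω ^ (a * s) := by
    intro k
    induction k with
    | zero => simp
    | succ k ih =>
      intro r
      have h : ∀ x, ω ^ ((n + x) * s) = ω ^ (x * s) := fun x => by
        rw [add_mul, pow_add, pow_mul, hω.pow_eq_one, one_pow, one_mul]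
      rw [show n * (k + 1) + r = n + (n * k + r) by ring, Finset.sum_range_add]
      simp_rw [h]
      rw [ih, sum_range_pow_rootOfUnity hω]
      split_ifs <;> push_cast <;> ring
  conv_lhs => rw [← Nat.div_add_mod q n]
  exact hblock _ _

theorem dvd_mul_gJ_iff {n : ℕ} (t : Fin d → ℕ) (J : Finset (Fin d)) (m : ℕ) :
    (∀ j ∈ J, n ∣ m * t j) ↔ n ∣ m * gJ n t J := by
  rw [gJ, ← Nat.gcd_mul_left, Nat.dvd_gcd_iff, and_iff_left (dvd_mul_left n m),
    ← Finset.dvd_gcd_iff, Finset.gcd_mul_left]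
  simp

theorem gJ_dvd (n : ℕ) (t : Fin d → ℕ) (J : Finset (Fin d)) : gJ n t J ∣ n :=
  Nat.gcd_dvd_right _ _

theorem gJ_pos {n : ℕ} (hn : 0 < n) (t : Fin d → ℕ) (J : Finset (Fin d)) : 0 < gJ n t J :=
  Nat.gcd_pos_of_pos_right _ hn

/-- The characters of `ℤ / n` that are trivial on all `t j` with `j ∈ J` form the dual of
`ℤ / g_J`. -/
theorem sum_filter_dvd_eq {n : ℕ} (hn : 0 < n) (t : Fin d → ℕ) (J : Finset (Fin d)) (F : ℕ → ℂ) :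
    ∑ m ∈ (Finset.range n).filter (fun m => ∀ j ∈ J, n ∣ m * t j), F m =
      ∑ m ∈ Finset.range (gJ n t J), F (n / gJ n t J * m) := by
  have hg := gJ_pos hn t J
  have hgn := Nat.div_mul_cancel (gJ_dvd n t J)
  have hq : 0 < n / gJ n t J := Nat.div_pos (Nat.le_of_dvd hn (gJ_dvd n t J)) hg
  symm
  refine Finset.sum_bij (fun m _ => n / gJ n t J * m) ?_ ?_ ?_ (fun _ _ => rfl)
  · intro m hm
    rw [Finset.mem_range] at hm
    rw [Finset.mem_filter, Finset.mem_range, dvd_mul_gJ_iff]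
    constructor
    · calc n / gJ n t J * m < n / gJ n t J * gJ n t J := Nat.mul_lt_mul_of_pos_left hm hq
        _ = n := hgn
    · exact ⟨m, by rw [mul_right_comm, hgn]⟩
  · intro a _ b _ h
    exact Nat.eq_of_mul_eq_mul_left hq h
  · intro m hm
    rw [Finset.mem_filter, Finset.mem_range, dvd_mul_gJ_iff] at hm
    have h1 : n / gJ n t J * gJ n t J ∣ m * gJ n t J := by rw [hgn]; exact hm.2
    obtain ⟨b, rfl⟩ := Nat.dvd_of_mul_dvd_mul_right hg h1
    refine ⟨b, ?_, rfl⟩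
    rw [Finset.mem_range]
    refine Nat.lt_of_mul_lt_mul_left (a := n / gJ n t J) ?_
    rw [hgn]
    exact hm.1

theorem theta_eq_card (n : ℕ) (t : Fin d → ℕ) (r : ℕ) (J : Finset (Fin d)) :
    theta n t r J =
      Nat.card {a : {l : Fin d // l ∉ J} → Fin r // gJ n t J ∣ ∑ l, (a l : ℕ) * t l} := by
  simp_rw [theta, Nat.modEq_zero_iff_dvd]

theorem gJ_mul_theta_eq_sum {n : ℕ} (hn : 0 < n) {ω : ℂ} (hω : IsPrimitiveRoot ω n)
    (t : Fin d → ℕ) (r : ℕ) (J : Finset (Fin d)) :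
    (gJ n t J : ℂ) * (theta n t r J : ℂ) =
      ∑ m ∈ (Finset.range n).filter (fun m => ∀ j ∈ J, n ∣ m * t j),
        ∏ l ∈ Finset.univ \ J, ∑ a ∈ Finset.range r, ω ^ (m * (a * t l)) := by
  have hη : IsPrimitiveRoot (ω ^ (n / gJ n t J)) (gJ n t J) :=
    hω.pow hn (Nat.div_mul_cancel (gJ_dvd n t J)).symm
  rw [theta_eq_card, mul_card_congruence_eq_sum hη (fun l : {l : Fin d // l ∉ J} => t l) r,
    sum_filter_dvd_eq hn]
  refine Finset.sum_congr rfl fun m _ => ?_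
  simp_rw [← pow_mul, mul_assoc]
  exact (Finset.prod_subtype (p := fun l => l ∉ J) (Finset.univ \ J) (by simp)
    fun l => ∑ a ∈ Finset.range r, ω ^ (n / gJ n t J * (m * (a * t l)))).symm

/-- The number of points of the box `[0, q) ^ d` on which the weight `∑ i, a i * t i` vanishes
modulo `n`. -/
noncomputable def boxCount (n : ℕ) (t : Fin d → ℕ) (q : ℕ) : ℕ :=
  Nat.card {a : Fin d → Fin q // n ∣ ∑ i, (a i : ℕ) * t i}

/-- Splitting each side of the box into complete residue systems modulo `n` and a remainder of
length `q % n`, the set `J` records the coordinates that lie in the complete part. -/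
theorem mul_boxCount {n : ℕ} (hn : 0 < n) (t : Fin d → ℕ) (q : ℕ) :
    n * boxCount n t q =
      ∑ i ∈ Finset.range (d + 1), psi n t (q % n) i * (n * (q / n)) ^ i := by
  have hω := Complex.isPrimitiveRoot_exp n hn.ne'
  set ω := Complex.exp (2 * Real.pi * Complex.I / n)
  have key : ((n * boxCount n t q : ℕ) : ℂ) =
      ∑ J ∈ (Finset.univ : Finset (Fin d)).powerset,
        ((gJ n t J * theta n t (q % n) J * (n * (q / n)) ^ J.card : ℕ) : ℂ) := by
    rw [Nat.cast_mul, boxCount, mul_card_congruence_eq_sum hω]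
    have h : ∀ m, ∏ i, ∑ a ∈ Finset.range q, ω ^ (m * (a * t i)) =
        ∑ J ∈ (Finset.univ : Finset (Fin d)).powerset,
          if ∀ j ∈ J, n ∣ m * t j then (((n * (q / n) : ℕ) : ℂ) ^ J.card *
            ∏ l ∈ Finset.univ \ J, ∑ a ∈ Finset.range (q % n), ω ^ (m * (a * t l))) else 0 := by
      intro m
      simp_rw [mul_left_comm m, sum_range_pow_split hω q]
      rw [Finset.prod_add]
      refine Finset.sum_congr rfl fun J _ => ?_
      rw [Finset.prod_ite_zero, ite_mul, zero_mul, Finset.prod_const]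
      congr
    simp_rw [h]
    rw [Finset.sum_comm]
    refine Finset.sum_congr rfl fun J _ => ?_
    rw [← Finset.sum_filter, ← Finset.mul_sum, ← gJ_mul_theta_eq_sum hn hω]
    push_cast
    ring
  have key' := (by exact_mod_cast key : n * boxCount n t q =
      ∑ J ∈ (Finset.univ : Finset (Fin d)).powerset,
        gJ n t J * theta n t (q % n) J * (n * (q / n)) ^ J.card)
  rw [key', Finset.sum_powerset, Finset.card_univ, Fintype.card_fin]
  refine Finset.sum_congr rfl fun i _ => ?_
  rw [psi, Finset.sum_mul]
  exact Finset.sum_congr rfl fun J hJ => by rw [(Finset.mem_powersetCard.mp hJ).2]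

end CyclicQuotient

/-! ### The box count as a quasi-polynomial -/

namespace CyclicQuotient

open Polynomial

variable {d : ℕ}

/-- The coefficients of a quasi-polynomial are determined by its values: along a residue class
modulo a common period both expansions are polynomials in `p ^ e`, with infinitely many common
values. -/
theorem IsQuasiPolynomial.unique {F : ℕ → ℕ} {p : ℕ} (hp : 1 < p) {φ φ' : Fin (d + 1) → ℕ → ℚ}
    (h : IsQuasiPolynomial F p d φ) (h' : IsQuasiPolynomial F p d φ') : φ = φ' := by
  choose N hN hφ using h.periodic
  choose N' hN' hφ' using h'.periodic
  obtain ⟨M, hM, hφM, hφM'⟩ : ∃ M : ℕ, 0 < M ∧ (∀ c, Function.Periodic (φ c) M) ∧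
      ∀ c, Function.Periodic (φ' c) M := by
    refine ⟨(∏ c, N c) * ∏ c, N' c, Nat.mul_pos (Finset.prod_pos fun c _ => hN c)
      (Finset.prod_pos fun c _ => hN' c), fun c => ?_, fun c => ?_⟩
    · obtain ⟨m, hm⟩ := (Finset.dvd_prod_of_mem N (Finset.mem_univ c)).mul_right (∏ c, N' c)
      rw [hm, mul_comm]
      exact (hφ c).nat_mul m
    · obtain ⟨m, hm⟩ := (Finset.dvd_prod_of_mem N' (Finset.mem_univ c)).mul_left (∏ c, N c)
      rw [hm, mul_comm]
      exact (hφ' c).nat_mul m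
  funext c e
  let Q : ℚ[X] := ∑ c : Fin (d + 1), monomial (c : ℕ) (φ c e - φ' c e)
  have hroot : ∀ j : ℕ, Q.IsRoot ((p : ℚ) ^ (e + j * M)) := by
    intro j
    have h1 := h.expansion (e + j * M)
    rw [h'.expansion (e + j * M)] at h1
    have h2 : ∀ c, φ c (e + j * M) = φ c e := fun c => (hφM c).nat_mul j e
    have h3 : ∀ c, φ' c (e + j * M) = φ' c e := fun c => (hφM' c).nat_mul j e
    simp_rw [h2, h3] at h1
    rw [IsRoot.def, eval_finsetSum]
    simp_rw [eval_monomial, sub_mul, ← pow_mul, mul_comm (e + j * M)]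
    rw [Finset.sum_sub_distrib, h1, sub_self]
  have hQ : Q = 0 := by
    refine eq_zero_of_infinite_isRoot Q (Set.Infinite.mono (Set.range_subset_iff.mpr hroot)
      (Set.infinite_range_of_injective fun i j hij => ?_))
    have h1 := Nat.pow_right_injective hp (by exact_mod_cast hij : p ^ (e + i * M) = p ^ (e + j * M))
    exact Nat.eq_of_mul_eq_mul_right hM (Nat.add_left_cancel h1)
  have hc : Q.coeff c = φ c e - φ' c e := by
    rw [finsetSum_coeff, Finset.sum_eq_single c]
    · simp
    · intro b _ hb
      rw [coeff_monomial, if_neg fun h => hb (Fin.ext h)]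
    · simp
  rw [hQ, coeff_zero] at hc
  exact sub_eq_zero.mp hc.symm

/-- The polynomial with coefficients `δ 0, …, δ d` in powers of `X - r`. -/
noncomputable def shiftedPolynomial (d : ℕ) (r : ℚ) (δ : ℕ → ℚ) : ℚ[X] :=
  ∑ i ∈ Finset.range (d + 1), C (δ i) * (X - C r) ^ i

theorem coeff_shiftedPolynomial {r : ℚ} {δ : ℕ → ℚ} {c : ℕ} (hc : c ≤ d)
    (h : ∀ i, c < i → i ≤ d → δ i = 0) : (shiftedPolynomial d r δ).coeff c = δ c := by
  have hdeg : ∀ i : ℕ, ((X - C r) ^ i).natDegree = i := fun i => by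
    rw [natDegree_pow, natDegree_X_sub_C, mul_one]
  rw [shiftedPolynomial, finsetSum_coeff, Finset.sum_eq_single c]
  · have h1 := ((monic_X_sub_C r).pow c).coeff_natDegree
    rw [hdeg] at h1
    rw [coeff_C_mul, h1, mul_one]
  · intro i hi hic
    rw [coeff_C_mul]
    rcases lt_or_gt_of_ne hic with h1 | h1
    · rw [coeff_eq_zero_of_natDegree_lt (by rwa [hdeg]), mul_zero]
    · rw [h i h1 (Nat.lt_succ_iff.mp (Finset.mem_range.mp hi)), zero_mul]
  · intro h1
    exact absurd (Finset.mem_range.mpr (Nat.lt_succ_of_le hc)) h1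

theorem coeff_shiftedPolynomial_eq_zero_iff {r : ℚ} {δ : ℕ → ℚ} {c : ℕ} :
    (∀ i, c ≤ i → i ≤ d → (shiftedPolynomial d r δ).coeff i = 0) ↔
      ∀ i, c ≤ i → i ≤ d → δ i = 0 := by
  constructor
  · intro h
    have key : ∀ m i, d - i = m → c ≤ i → i ≤ d → δ i = 0 := by
      intro m
      induction m using Nat.strong_induction_on with
      | _ m ih =>
        intro i him hci hid
        rw [← coeff_shiftedPolynomial (r := r) hid fun j hij hjd =>
          ih (d - j) (by omega) j rfl (by omega) hjd]
        exact h i hci hid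
    exact fun i => key _ i rfl
  · intro h i hci hid
    rw [coeff_shiftedPolynomial hid fun j hij => h j (by omega)]
    exact h i hci hid

/-- The difference between `ψ_i` and the value it has when `g_J = 1` for all `J` with `i`
elements. -/
noncomputable def psiDefect (n : ℕ) (t : Fin d → ℕ) (r i : ℕ) : ℚ :=
  psi n t r i - (d.choose i : ℚ) * (r : ℚ) ^ (d - i)

/-- The polynomial which takes the value `boxCount n t q` at every `q` with remainder `r`
modulo `n`. -/
noncomputable def boxPolynomial (n : ℕ) (t : Fin d → ℕ) (r : ℕ) : ℚ[X] :=
  C (n : ℚ)⁻¹ * shiftedPolynomial d r fun i => psi n t r i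

theorem natDegree_boxPolynomial_lt (n : ℕ) (t : Fin d → ℕ) (r : ℕ) :
    (boxPolynomial n t r).natDegree < d + 1 := by
  refine Nat.lt_succ_of_le ((natDegree_C_mul_le _ _).trans (natDegree_sum_le_of_forall_le _ _ ?_))
  intro i hi
  refine (natDegree_C_mul_le _ _).trans ?_
  rw [natDegree_pow, natDegree_X_sub_C, mul_one]
  exact Nat.lt_succ_iff.mp (Finset.mem_range.mp hi)

theorem eval_boxPolynomial {n : ℕ} (hn : 0 < n) (t : Fin d → ℕ) (q : ℕ) :
    (boxPolynomial n t (q % n)).eval (q : ℚ) = boxCount n t q := by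
  have hn' : (n : ℚ) ≠ 0 := by exact_mod_cast hn.ne'
  have hq : (q : ℚ) - ((q % n : ℕ) : ℚ) = ((n * (q / n) : ℕ) : ℚ) := by
    rw [sub_eq_iff_eq_add]
    exact_mod_cast (Nat.div_add_mod q n).symm
  have h : ((n * boxCount n t q : ℕ) : ℚ) = _ := congrArg Nat.cast (mul_boxCount hn t q)
  rw [boxPolynomial, eval_C_mul, inv_mul_eq_iff_eq_mul₀ hn', ← Nat.cast_mul, h, shiftedPolynomial,
    eval_finsetSum]
  simp_rw [eval_C_mul, eval_pow, eval_sub, eval_X, eval_C, hq]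
  push_cast
  rfl

theorem coeff_boxPolynomial {n : ℕ} (t : Fin d → ℕ) (r c : ℕ) (hc : c < d) :
    (boxPolynomial n t r).coeff c =
      (shiftedPolynomial d r (psiDefect n t r)).coeff c / n := by
  have h : shiftedPolynomial d (r : ℚ) (fun i => (psi n t r i : ℚ)) =
      shiftedPolynomial d r (psiDefect n t r) + X ^ d := by
    have hX : (X : ℚ[X]) ^ d = shiftedPolynomial d r fun i => (d.choose i : ℚ) * (r : ℚ) ^ (d - i) := by
      conv_lhs => rw [← sub_add_cancel X (C (r : ℚ)), add_pow]
      refine Finset.sum_congr rfl fun i _ => ?_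
      rw [C_mul, C_pow, map_natCast C (d.choose i)]
      ring
    rw [hX, shiftedPolynomial, shiftedPolynomial, shiftedPolynomial, ← Finset.sum_add_distrib]
    refine Finset.sum_congr rfl fun i _ => ?_
    rw [← add_mul, ← C_add, psiDefect, sub_add_cancel]
  rw [boxPolynomial, coeff_C_mul, h, coeff_add, coeff_X_pow, if_neg hc.ne, add_zero, mul_comm,
    div_eq_mul_inv]

theorem gJ_dvd_of_subset (n : ℕ) (t : Fin d → ℕ) {I J : Finset (Fin d)} (h : I ⊆ J) :
    gJ n t J ∣ gJ n t I :=
  Nat.gcd_dvd_gcd_of_dvd_left n (Finset.gcd_mono h)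

theorem theta_eq_pow (n : ℕ) (t : Fin d → ℕ) (r : ℕ) (J : Finset (Fin d)) (h : gJ n t J = 1) :
    theta n t r J = r ^ (d - J.card) := by
  rw [theta_eq_card, h, Nat.card_congr (Equiv.subtypeUnivEquiv fun _ => one_dvd _), Nat.card_fun,
    Nat.card_fin, Nat.card_eq_fintype_card, Fintype.card_subtype_compl, Fintype.card_fin,
    Fintype.card_coe]

theorem theta_one (n : ℕ) (t : Fin d → ℕ) (J : Finset (Fin d)) : theta n t 1 J = 1 := by
  rw [theta_eq_card, Nat.card_congr (Equiv.subtypeUnivEquiv fun _ => by simp)]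
  simp

theorem psiDefect_eq_zero (n : ℕ) (t : Fin d → ℕ) (r i : ℕ)
    (h : ∀ J : Finset (Fin d), J.card = i → gJ n t J = 1) : psiDefect n t r i = 0 := by
  have h1 : psi n t r i = d.choose i * r ^ (d - i) := by
    rw [psi, Finset.sum_congr rfl (g := fun _ => r ^ (d - i)), Finset.sum_const,
      Finset.card_powersetCard, Finset.card_univ, Fintype.card_fin, smul_eq_mul]
    intro J hJ
    have hJ' := (Finset.mem_powersetCard.mp hJ).2
    rw [theta_eq_pow n t r J (h J hJ'), h J hJ', one_mul, hJ']
  rw [psiDefect, h1]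
  push_cast
  ring

/-- For `n > 1` the remainder `1 % n` is `1`, where every `θ_J` equals `1`; then `psiDefect` is the
sum of the nonnegative numbers `g_J - 1`. -/
theorem gJ_eq_one_of_psiDefect_eq_zero {n : ℕ} (hn : 0 < n) (t : Fin d → ℕ) (i : ℕ)
    (h : psiDefect n t (1 % n) i = 0) (J : Finset (Fin d)) (hJ : J.card = i) : gJ n t J = 1 := by
  rcases Nat.lt_or_ge 1 n with h1 | h1
  · rw [Nat.mod_eq_of_lt h1, psiDefect, Nat.cast_one, one_pow, mul_one, sub_eq_zero,
      Nat.cast_inj, psi] at h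
    simp_rw [theta_one, mul_one] at h
    have h2 : d.choose i = ∑ J ∈ Finset.powersetCard i (Finset.univ : Finset (Fin d)), 1 := by
      rw [Finset.sum_const, Finset.card_powersetCard, Finset.card_univ, Fintype.card_fin,
        smul_eq_mul, mul_one]
    rw [h2, eq_comm, Finset.sum_eq_sum_iff_of_le fun J _ => gJ_pos hn t J] at h
    exact (h J (Finset.mem_powersetCard.mpr ⟨Finset.subset_univ J, hJ⟩)).symm
  · obtain rfl : n = 1 := by omega
    exact Nat.dvd_one.mp (gJ_dvd 1 t J)

theorem pow_mod_periodic {p n : ℕ} (h : Nat.Coprime p n) :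
    Function.Periodic (fun e => p ^ e % n) n.totient := by
  intro e
  have h1 : p ^ (e + n.totient) ≡ p ^ e * 1 [MOD n] := by
    rw [pow_add]
    exact (Nat.ModEq.pow_totient h).mul_left _
  rw [mul_one] at h1
  exact h1

theorem isQuasiPolynomial_boxCount {n : ℕ} (hn : 0 < n) (t : Fin d → ℕ) {p : ℕ}
    (h : Nat.Coprime p n) :
    IsQuasiPolynomial (fun e => boxCount n t (p ^ e)) p d
      fun c e => (boxPolynomial n t (p ^ e % n)).coeff c where
  periodic c := ⟨n.totient, Nat.totient_pos.mpr hn, fun e =>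
    congrArg (fun r => (boxPolynomial n t r).coeff c) (pow_mod_periodic h e)⟩
  expansion e := by
    rw [← eval_boxPolynomial hn, eval_eq_sum_range' (natDegree_boxPolynomial_lt _ _ _),
      Fin.sum_univ_eq_sum_range
        (fun c => (boxPolynomial n t (p ^ e % n)).coeff c * (p : ℚ) ^ (c * e))]
    refine Finset.sum_congr rfl fun c _ => ?_
    rw [Nat.cast_pow, ← pow_mul, mul_comm e]

end CyclicQuotient

/-! ### The free rank of `R^{1/q}` -/

namespace CyclicQuotient

open MvPowerSeries

/-- The additive identification `x ↦ x ^ (1 / p ^ e)` of `R` with `R^{1/p^e}`. -/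
def rootEquiv (R : Type*) [CommRing R] (p e : ℕ) : R ≃+ FrobeniusRoot R p e :=
  AddEquiv.refl R

theorem smul_rootEquiv {R : Type*} [CommRing R] (p e : ℕ) [ExpChar R p] (r x : R) :
    r • rootEquiv R p e x = rootEquiv R p e (r ^ p ^ e * x) := rfl

theorem freeRank_set_subset_of_ringEquiv {R R' : Type*} [CommRing R] [CommRing R'] (p e : ℕ)
    [ExpChar R p] [ExpChar R' p] (σ : R ≃+* R') :
    {m : ℕ | ∃ f : FrobeniusRoot R p e →ₗ[R] (Fin m → R), Function.Surjective f} ⊆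
      {m : ℕ | ∃ f : FrobeniusRoot R' p e →ₗ[R'] (Fin m → R'), Function.Surjective f} := by
  rintro m ⟨f, hf⟩
  let τ : FrobeniusRoot R' p e ≃+ FrobeniusRoot R p e :=
    (rootEquiv R' p e).symm.trans (σ.symm.toAddEquiv.trans (rootEquiv R p e))
  have hτ : ∀ (r : R') (x : FrobeniusRoot R' p e), τ (r • x) = σ.symm r • τ x := fun r x => by
    obtain ⟨y, rfl⟩ := (rootEquiv R' p e).surjective x
    change rootEquiv R p e (σ.symm (r ^ p ^ e * y)) = σ.symm r • rootEquiv R p e (σ.symm y)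
    rw [smul_rootEquiv, map_mul, map_pow]
  refine ⟨{ toFun := fun x j => σ (f (τ x) j), map_add' := ?_, map_smul' := ?_ }, ?_⟩
  · intro x y
    funext j
    simp
  · intro r x
    funext j
    simp [hτ]
  · intro y
    obtain ⟨x, hx⟩ := hf fun j => σ.symm (y j)
    refine ⟨τ.symm x, ?_⟩
    funext j
    simp [hx]

theorem FS_congr {R R' : Type*} [CommRing R] [CommRing R'] (p : ℕ)
    [ExpChar R p] [ExpChar R' p] (σ : R ≃+* R') (e : ℕ) : FS R p e = FS R' p e :=
  congrArg sSup (Set.Subset.antisymm (freeRank_set_subset_of_ringEquiv p e σ)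
    (freeRank_set_subset_of_ringEquiv p e σ.symm))

variable {k : Type*} [Field k] {d : ℕ}

section Monomials

variable {n : ℕ} {t : Fin d → ℕ}

theorem monomial_mem_weightSubalgebra {u : Fin d →₀ ℕ} (hu : n ∣ Finsupp.weight t u) (c : k) :
    monomial u c ∈ weightSubalgebra k n t := by
  classical
  intro v hv
  rw [coeff_monomial] at hv
  rwa [(ite_ne_right_iff.mp hv).1]

/-- The monomial `x ^ u` as an element of the ring of series of weight zero modulo `n`. -/
noncomputable def weightMonomial (k : Type*) [Field k] (u : Fin d →₀ ℕ)
    (hu : n ∣ Finsupp.weight t u) : weightSubalgebra k n t :=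
  ⟨monomial u 1, monomial_mem_weightSubalgebra hu 1⟩

/-- When the weights of all variables but one generate `ℤ / n`, every variable has the weight of
a monomial in the other variables. -/
theorem exists_weight_modEq (hn : 0 < n) (i : Fin d) (h : gJ n t (Finset.univ.erase i) = 1) :
    ∃ v : Fin d →₀ ℕ, v i = 0 ∧ Finsupp.weight t v ≡ t i [MOD n] := by
  obtain ⟨n', rfl⟩ := Nat.exists_eq_succ_of_ne_zero hn.ne'
  let A : AddSubgroup ℤ :=
    { carrier := {x | ∃ v : Fin d →₀ ℕ, v i = 0 ∧ ((n' + 1 : ℕ) : ℤ) ∣ Finsupp.weight t v - x}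
      add_mem' := by
        rintro x y ⟨v, hv, hx⟩ ⟨w, hw, hy⟩
        refine ⟨v + w, by simp [hv, hw], ?_⟩
        obtain ⟨x', hx⟩ := hx
        obtain ⟨y', hy⟩ := hy
        refine ⟨x' + y', ?_⟩
        rw [map_add]
        push_cast at hx hy ⊢
        linear_combination hx + hy
      zero_mem' := ⟨0, rfl, by simp⟩
      neg_mem' := by
        rintro x ⟨v, hv, hx⟩
        refine ⟨n' • v, by simp [hv], ?_⟩
        rw [map_nsmul]
        obtain ⟨y, hy⟩ := hx
        refine ⟨Finsupp.weight t v - y, ?_⟩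
        push_cast at hy ⊢
        rw [nsmul_eq_mul]
        push_cast
        linear_combination -hy }
  obtain ⟨a, ha⟩ := Int.subgroup_cyclic A
  have hdvd : ∀ x ∈ A, a ∣ x := by
    intro x hx
    rw [ha, AddSubgroup.mem_closure_singleton] at hx
    obtain ⟨c, rfl⟩ := hx
    exact ⟨c, by rw [smul_eq_mul, mul_comm]⟩
  have h1 : a.natAbs ∣ gJ (n' + 1) t (Finset.univ.erase i) := by
    refine Nat.dvd_gcd (Finset.dvd_gcd fun j hj => ?_) ?_
    · have hj' : j ≠ i := (Finset.mem_erase.mp hj).1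
      exact Int.natAbs_dvd_natAbs.mpr (hdvd (t j) ⟨Finsupp.single j 1, by simp [hj'], by
        simp [Finsupp.weight_single]⟩)
    · exact Int.natAbs_dvd_natAbs.mpr (hdvd ((n' + 1 : ℕ) : ℤ) ⟨0, rfl, by
        rw [map_zero, Nat.cast_zero, zero_sub, dvd_neg]⟩)
  rw [h, Nat.dvd_one] at h1
  have h2 : (t i : ℤ) ∈ A := by
    rw [ha, AddSubgroup.mem_closure_singleton]
    rcases Int.natAbs_eq a with h3 | h3 <;> rw [h1] at h3
    · exact ⟨t i, by simp [h3]⟩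
    · exact ⟨-t i, by simp [h3]⟩
  obtain ⟨v, hv, hx⟩ := h2
  exact ⟨v, hv, (Nat.modEq_iff_dvd.mpr hx).symm⟩

end Monomials

section UpperBound

variable {n : ℕ} {t : Fin d → ℕ} {p e : ℕ} [ExpChar k p]

instance weightSubalgebra.expChar : ExpChar (weightSubalgebra k n t) p :=
  expChar_of_injective_algebraMap (algebraMap k (weightSubalgebra k n t)).injective p

/-- A linear map `R^{1/q} → R` takes the roots of series divisible by `x_i ^ q` into the maximal
ideal. For `v` without `x_i` and of the same weight as `x_i`, the series `h = f x_i^{-q} x^{q v}`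
lies in `R`; clearing denominators gives `x_i x^{(n-1) v} φ(h^{1/q}) = x^{n v} φ(f^{1/q})`, so
`x_i` divides `φ(f^{1/q})`. -/
theorem constantCoeff_eq_zero_of_le (hn : 0 < n) {i : Fin d} {v : Fin d →₀ ℕ} (hvi : v i = 0)
    (hv : Finsupp.weight t v ≡ t i [MOD n])
    (φ : FrobeniusRoot (weightSubalgebra k n t) p e →ₗ[weightSubalgebra k n t]
      weightSubalgebra k n t)
    (f : weightSubalgebra k n t)
    (hf : ∀ u, coeff u (f : MvPowerSeries (Fin d) k) ≠ 0 → p ^ e ≤ u i) :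
    constantCoeff (φ (rootEquiv _ p e f) : MvPowerSeries (Fin d) k) = 0 := by
  obtain ⟨g, hg⟩ : (X i : MvPowerSeries (Fin d) k) ^ p ^ e ∣ f := by
    rw [X_pow_dvd_iff]
    intro m hm
    by_contra h
    exact absurd (hf m h) (not_le.mpr hm)
  rw [X_pow_eq] at hg
  have hmem : monomial (p ^ e • v) 1 * g ∈ weightSubalgebra k n t := by
    intro u hu
    rw [coeff_monomial_mul, one_mul] at hu
    obtain ⟨hle, hu⟩ := ite_ne_right_iff.mp hu
    have h1 : coeff (Finsupp.single i (p ^ e) + (u - p ^ e • v)) (f : MvPowerSeries (Fin d) k)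
        ≠ 0 := by
      rwa [hg, coeff_add_monomial_mul, one_mul]
    have h2 := f.2 _ h1
    rw [map_add, Finsupp.weight_single, smul_eq_mul] at h2
    have h3 : Finsupp.weight t u =
        p ^ e * Finsupp.weight t v + Finsupp.weight t (u - p ^ e • v) := by
      rw [← smul_eq_mul, ← map_nsmul, ← map_add, add_tsub_cancel_of_le hle]
    rw [h3]
    exact (((hv.mul_left (p ^ e)).add_right _).dvd_iff dvd_rfl).mpr h2
  have hw : n ∣ Finsupp.weight t (Finsupp.single i 1 + (n - 1) • v) := by
    rw [map_add, Finsupp.weight_single, map_nsmul, smul_eq_mul, smul_eq_mul, one_mul]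
    refine ((hv.add_right _).dvd_iff dvd_rfl).mp ⟨Finsupp.weight t v, ?_⟩
    obtain ⟨n', rfl⟩ := Nat.exists_eq_succ_of_ne_zero hn.ne'
    rw [Nat.succ_sub_one, Nat.succ_mul, add_comm]
  have hnv : n ∣ Finsupp.weight t (n • v) := by
    rw [map_nsmul]
    exact dvd_mul_right _ _
  have hexp : p ^ e • (Finsupp.single i 1 + (n - 1) • v) + p ^ e • v =
      p ^ e • n • v + Finsupp.single i (p ^ e) := by
    obtain ⟨n', rfl⟩ := Nat.exists_eq_succ_of_ne_zero hn.ne'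
    rw [Nat.succ_sub_one, smul_add, Finsupp.smul_single, smul_eq_mul, mul_one, succ_nsmul,
      smul_add]
    abel
  have hrel : weightMonomial k _ hw ^ p ^ e * (⟨_, hmem⟩ : weightSubalgebra k n t) =
      weightMonomial k _ hnv ^ p ^ e * f := by
    apply Subtype.ext
    change (monomial (Finsupp.single i 1 + (n - 1) • v) (1 : k)) ^ p ^ e *
      (monomial (p ^ e • v) 1 * g) = (monomial (n • v) (1 : k)) ^ p ^ e * (f : MvPowerSeries _ _)
    rw [hg, monomial_pow, monomial_pow, ← mul_assoc, ← mul_assoc, monomial_mul_monomial,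
      monomial_mul_monomial, hexp]
  have hφ : weightMonomial k _ hw * φ (rootEquiv _ p e ⟨_, hmem⟩) =
      weightMonomial k _ hnv * φ (rootEquiv _ p e f) :=
    (map_smul φ _ _).symm.trans
      ((congrArg (fun z => φ (rootEquiv _ p e z)) hrel).trans (map_smul φ _ _))
  have hcoeff := congrArg (fun y : weightSubalgebra k n t =>
    coeff (n • v + 0) (y : MvPowerSeries (Fin d) k)) hφ
  change coeff (n • v + 0) (monomial (Finsupp.single i 1 + (n - 1) • v) (1 : k) * _) =
    coeff (n • v + 0) (monomial (n • v) (1 : k) * _) at hcoeff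
  rw [coeff_add_monomial_mul, one_mul, coeff_monomial_mul, if_neg] at hcoeff
  · exact hcoeff.symm
  · intro hle
    have := hle i
    simp [hvi] at this

/-- A linear map `R^{1/q} → R` takes the roots of series without monomials in the box
`[0, q) ^ d` into the maximal ideal: such a series is a sum of series in `R`, each divisible by
the `q`-th power of some variable. -/
theorem constantCoeff_eq_zero_of_exists_le (hn : 0 < n)
    (hv : ∀ i, ∃ v : Fin d →₀ ℕ, v i = 0 ∧ Finsupp.weight t v ≡ t i [MOD n])
    (φ : FrobeniusRoot (weightSubalgebra k n t) p e →ₗ[weightSubalgebra k n t]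
      weightSubalgebra k n t)
    (s : Finset (Fin d)) (f : weightSubalgebra k n t)
    (hf : ∀ u, coeff u (f : MvPowerSeries (Fin d) k) ≠ 0 → ∃ i ∈ s, p ^ e ≤ u i) :
    constantCoeff (φ (rootEquiv _ p e f) : MvPowerSeries (Fin d) k) = 0 := by
  classical
  induction s using Finset.induction_on generalizing f with
  | empty =>
    have : f = 0 := by
      apply Subtype.ext
      ext u
      by_contra h
      obtain ⟨i, hi, -⟩ := hf u h
      simp at hi
    simp [this]
  | insert i s _ ih =>
    -- `F₁` collects the monomials divisible by `x_i ^ q`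
    let F₁ : MvPowerSeries (Fin d) k := fun u => if p ^ e ≤ u i then coeff u f.1 else 0
    have hF₁ : ∀ u, coeff u F₁ = if p ^ e ≤ u i then coeff u f.1 else 0 := fun u => rfl
    have hmem : F₁ ∈ weightSubalgebra k n t := by
      intro u hu
      rw [hF₁] at hu
      exact f.2 u (ite_ne_right_iff.mp hu).2
    obtain ⟨v, hvi, hvw⟩ := hv i
    have h1 := constantCoeff_eq_zero_of_le hn hvi hvw φ ⟨F₁, hmem⟩ fun u hu => by
      change coeff u F₁ ≠ 0 at hu
      rw [hF₁] at hu
      exact (ite_ne_right_iff.mp hu).1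
    have h2 := ih (f - ⟨F₁, hmem⟩) fun u hu => by
      change coeff u (f.1 - F₁) ≠ 0 at hu
      rw [map_sub, hF₁] at hu
      split_ifs at hu with h
      · simp at hu
      · rw [sub_zero] at hu
        obtain ⟨j, hj, hju⟩ := hf u hu
        rcases Finset.mem_insert.mp hj with rfl | hj
        · exact absurd hju h
        · exact ⟨j, hj, hju⟩
    have h3 : f = ⟨F₁, hmem⟩ + (f - ⟨F₁, hmem⟩) := by abel
    rw [h3, map_add, map_add]
    change constantCoeff (_ + _ : MvPowerSeries (Fin d) k) = 0
    rw [map_add, h1, h2, add_zero]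

/-- A point of the box `[0, q) ^ d` as an exponent. -/
noncomputable def boxExponent {q : ℕ} (a : Fin d → Fin q) : Fin d →₀ ℕ :=
  Finsupp.equivFunOnFinite.symm fun i => (a i : ℕ)

theorem boxExponent_injective {q : ℕ} :
    Function.Injective (boxExponent : (Fin d → Fin q) → Fin d →₀ ℕ) := by
  intro a b h
  funext i
  exact Fin.ext (DFunLike.congr_fun h i)

theorem weight_boxExponent {q : ℕ} (a : Fin d → Fin q) :
    Finsupp.weight t (boxExponent a) = ∑ i, (a i : ℕ) * t i :=
  weight_eq_sum t _

theorem dvd_weight_boxExponent {q : ℕ}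
    (a : {a : Fin d → Fin q // n ∣ ∑ i, (a i : ℕ) * t i}) :
    n ∣ Finsupp.weight t (boxExponent a.1) := by
  rw [weight_boxExponent]
  exact a.2

/-- Modulo the maximal ideal a surjection `R^{1/q} → R ^ m` only sees the monomials in the box
`[0, q) ^ d`. -/
theorem le_boxCount_of_surjective [PerfectRing k p] (hn : 0 < n)
    (hv : ∀ i, ∃ v : Fin d →₀ ℕ, v i = 0 ∧ Finsupp.weight t v ≡ t i [MOD n]) {m : ℕ}
    (φ : FrobeniusRoot (weightSubalgebra k n t) p e →ₗ[weightSubalgebra k n t]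
      (Fin m → weightSubalgebra k n t)) (hφ : Function.Surjective φ) :
    m ≤ boxCount n t (p ^ e) := by
  classical
  let ι := {a : Fin d → Fin (p ^ e) // n ∣ ∑ i, (a i : ℕ) * t i}
  let root := rootEquiv (weightSubalgebra k n t) p e
  let y : ι → Fin m → k := fun a j =>
    constantCoeff (φ (root (weightMonomial k _ (dvd_weight_boxExponent a))) j :
      MvPowerSeries (Fin d) k)
  have hsurj : Function.Surjective (Fintype.linearCombination k y) := by
    intro z
    obtain ⟨x, hx⟩ := hφ fun j => algebraMap k _ (z j)
    obtain ⟨f, rfl⟩ := root.surjective x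
    let c : ι → k := fun a =>
      (iterateFrobeniusEquiv k p e).symm (coeff (boxExponent a.1) (f : MvPowerSeries (Fin d) k))
    have hc : ∀ a, c a ^ p ^ e = coeff (boxExponent a.1) (f : MvPowerSeries (Fin d) k) := fun a => by
      rw [← iterateFrobeniusEquiv_def, RingEquiv.apply_symm_apply]
    let f' : weightSubalgebra k n t := ∑ a, (algebraMap k _ (c a)) ^ p ^ e *
      weightMonomial k _ (dvd_weight_boxExponent a)
    have hroot : root f' = ∑ a, (algebraMap k (weightSubalgebra k n t) (c a)) •
        root (weightMonomial k _ (dvd_weight_boxExponent a)) := by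
      rw [map_sum]
      exact Finset.sum_congr rfl fun a _ => rfl
    have hf' : ∀ u, coeff u (f' : MvPowerSeries (Fin d) k) = ∑ a : ι,
        if u = boxExponent a.1 then coeff (boxExponent a.1) (f : MvPowerSeries (Fin d) k)
          else 0 := by
      intro u
      have h : (f' : MvPowerSeries (Fin d) k) =
          ∑ a : ι, C (c a ^ p ^ e) * monomial (boxExponent a.1) 1 := by
        rw [AddSubmonoidClass.coe_finsetSum]
        refine Finset.sum_congr rfl fun a _ => ?_
        rw [C.map_pow]
        rfl
      rw [h, map_sum]
      refine Finset.sum_congr rfl fun a _ => ?_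
      rw [coeff_C_mul, coeff_monomial, mul_ite, mul_one, mul_zero, hc]
    have hker : ∀ u, coeff u ((f - f' : weightSubalgebra k n t) : MvPowerSeries (Fin d) k) ≠ 0 →
        ∃ i ∈ Finset.univ, p ^ e ≤ u i := by
      intro u hu
      by_contra! hlt
      apply hu
      change coeff u (f.1 - f'.1) = 0
      rw [map_sub, sub_eq_zero, hf']
      let a : Fin d → Fin (p ^ e) := fun i => ⟨u i, hlt i (Finset.mem_univ i)⟩
      have hau : boxExponent a = u := Finsupp.ext fun i => rfl
      by_cases ha : n ∣ ∑ i, (a i : ℕ) * t i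
      · rw [Finset.sum_eq_single ⟨a, ha⟩]
        · rw [if_pos hau.symm, hau]
        · intro b _ hb
          refine if_neg fun h => hb (Subtype.ext (boxExponent_injective ?_))
          rw [← h, hau]
        · simp
      · rw [Finset.sum_eq_zero]
        · by_contra h
          refine ha ?_
          rw [← weight_boxExponent, hau]
          exact f.2 u h
        · intro b _
          refine if_neg fun h => ha ?_
          rw [← weight_boxExponent, hau, h]
          exact dvd_weight_boxExponent b
    refine ⟨c, funext fun j => ?_⟩
    have h1 := constantCoeff_eq_zero_of_exists_le hn hv (LinearMap.proj j ∘ₗ φ) Finset.univ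
      (f - f') hker
    change constantCoeff (φ (root (f - f')) j : MvPowerSeries (Fin d) k) = 0 at h1
    rw [map_sub, map_sub, hx, hroot, map_sum, Pi.sub_apply, Finset.sum_apply] at h1
    simp_rw [map_smul, Pi.smul_apply, smul_eq_mul] at h1
    rw [AddSubgroupClass.coe_sub, map_sub, sub_eq_zero, AddSubmonoidClass.coe_finsetSum, map_sum]
      at h1
    have h2 : constantCoeff ((algebraMap k (weightSubalgebra k n t) (z j) :
        weightSubalgebra k n t) : MvPowerSeries (Fin d) k) = z j := constantCoeff_C (z j)
    rw [h2] at h1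
    rw [Fintype.linearCombination_apply, Finset.sum_apply, h1]
    refine Finset.sum_congr rfl fun a _ => ?_
    change c a * y a j = constantCoeff (C (c a) * _)
    rw [map_mul, constantCoeff_C]
  have h := LinearMap.finrank_le_finrank_of_surjective hsurj
  rwa [Module.finrank_fin_fun, Module.finrank_fintype_fun_eq_card, ← Nat.card_eq_fintype_card] at h

end UpperBound

section LowerBound

variable {n : ℕ} {t : Fin d → ℕ} {p e : ℕ} [ExpChar k p]

theorem coeff_smul_pow (r : MvPowerSeries (Fin d) k) (u : Fin d →₀ ℕ) :
    coeff (p ^ e • u) (r ^ p ^ e) = coeff u r ^ p ^ e := by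
  rw [← map_iterateFrobenius_expand p (expChar_ne_zero k p), coeff_map, coeff_expand_smul,
    iterateFrobenius_def]

theorem dvd_of_coeff_pow_ne_zero (r : MvPowerSeries (Fin d) k) (u : Fin d →₀ ℕ)
    (h : coeff u (r ^ p ^ e) ≠ 0) (i : Fin d) : p ^ e ∣ u i := by
  by_contra hi
  refine h ?_
  rw [← map_iterateFrobenius_expand p (expChar_ne_zero k p), coeff_map,
    coeff_expand_of_not_dvd _ _ _ hi, map_zero]

theorem coeff_pow_mul (r f : MvPowerSeries (Fin d) k) (a b : Fin d →₀ ℕ)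
    (ha : ∀ i, a i < p ^ e) :
    coeff (a + p ^ e • b) (r ^ p ^ e * f) =
      ∑ x ∈ Finset.HasAntidiagonal.antidiagonal b, coeff x.1 r ^ p ^ e * coeff (a + p ^ e • x.2) f := by
  classical
  have hq : p ^ e ≠ 0 := pow_ne_zero _ (expChar_ne_zero k p)
  rw [coeff_mul]
  symm
  refine Finset.sum_of_injOn (fun x => (p ^ e • x.1, a + p ^ e • x.2)) ?_ ?_ ?_ ?_
  · rintro ⟨x, y⟩ - ⟨x', y'⟩ - h
    simp only [Prod.mk.injEq, add_right_inj] at h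
    exact Prod.ext (nsmul_right_injective hq h.1) (nsmul_right_injective hq h.2)
  · rintro ⟨x, y⟩ h
    simp only [Finset.mem_coe, Finset.HasAntidiagonal.mem_antidiagonal] at h ⊢
    rw [← h, smul_add]
    abel
  · rintro ⟨x, y⟩ h hne
    simp only [Finset.HasAntidiagonal.mem_antidiagonal] at h
    by_contra h0
    refine hne ?_
    have hdvd := dvd_of_coeff_pow_ne_zero r x (left_ne_zero_of_mul h0)
    choose x' hx' using hdvd
    obtain ⟨x'', rfl⟩ : ∃ x'' : Fin d →₀ ℕ, x = p ^ e • x'' :=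
      ⟨Finsupp.equivFunOnFinite.symm x', Finsupp.ext fun i => hx' i⟩
    have hle : x'' ≤ b := by
      intro i
      have h1 := DFunLike.congr_fun h i
      simp only [Finsupp.add_apply, Finsupp.smul_apply, smul_eq_mul] at h1
      have h2 : p ^ e * x'' i < p ^ e * (b i + 1) := by
        have := ha i
        rw [mul_add, mul_one]
        omega
      exact Nat.lt_succ_iff.mp (Nat.lt_of_mul_lt_mul_left h2)
    obtain ⟨z, rfl⟩ := le_iff_exists_add.mp hle
    refine ⟨(x'', z), by simp, Prod.ext rfl ?_⟩
    rw [smul_add, add_left_comm] at h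
    exact (add_left_cancel h).symm
  · rintro ⟨x, y⟩ -
    rw [coeff_smul_pow]

variable [PerfectRing k p]

/-- The coordinate at `x ^ (a / q)` of the `q`-th root of a power series, with respect to the
basis of the `x ^ (a / q)`, `a ∈ [0, q) ^ d`. -/
noncomputable def rootComponent (p e : ℕ) [ExpChar k p] [PerfectRing k p] (a : Fin d →₀ ℕ)
    (f : MvPowerSeries (Fin d) k) : MvPowerSeries (Fin d) k :=
  fun b => (iterateFrobeniusEquiv k p e).symm (coeff (a + p ^ e • b) f)

theorem coeff_rootComponent (a b : Fin d →₀ ℕ) (f : MvPowerSeries (Fin d) k) :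
    coeff b (rootComponent p e a f) =
      (iterateFrobeniusEquiv k p e).symm (coeff (a + p ^ e • b) f) := rfl

theorem rootComponent_add (a : Fin d →₀ ℕ) (f g : MvPowerSeries (Fin d) k) :
    rootComponent p e a (f + g) = rootComponent p e a f + rootComponent p e a g := by
  ext b
  simp [coeff_rootComponent]

theorem rootComponent_pow_mul (a : Fin d →₀ ℕ) (ha : ∀ i, a i < p ^ e)
    (r f : MvPowerSeries (Fin d) k) :
    rootComponent p e a (r ^ p ^ e * f) = r * rootComponent p e a f := by
  classical
  ext b
  rw [coeff_rootComponent, coeff_pow_mul r f a b ha, coeff_mul, map_sum]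
  refine Finset.sum_congr rfl fun x _ => ?_
  rw [map_mul, coeff_rootComponent, ← iterateFrobeniusEquiv_def, RingEquiv.symm_apply_apply]

theorem rootComponent_mem (hpn : Nat.Coprime p n) {a : Fin d →₀ ℕ} (ha : n ∣ Finsupp.weight t a)
    {f : MvPowerSeries (Fin d) k} (hf : f ∈ weightSubalgebra k n t) :
    rootComponent p e a f ∈ weightSubalgebra k n t := by
  intro b hb
  have h1 : coeff (a + p ^ e • b) f ≠ 0 := fun h => hb (by rw [coeff_rootComponent, h, map_zero])
  have h2 := hf _ h1
  rw [map_add, map_nsmul, smul_eq_mul] at h2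
  exact (hpn.pow_left e).symm.dvd_of_dvd_mul_left ((Nat.dvd_add_right ha).mp h2)

theorem rootComponent_monomial (a b : Fin d →₀ ℕ)
    (hb : ∀ i, b i < p ^ e) :
    rootComponent p e a (monomial b (1 : k)) = if a = b then 1 else 0 := by
  classical
  ext c
  rw [coeff_rootComponent, coeff_monomial]
  by_cases hc : c = 0
  · subst hc
    rw [smul_zero, add_zero]
    split_ifs <;> simp
  · have h1 : a + p ^ e • c ≠ b := by
      intro h
      obtain ⟨i, hi⟩ := Finsupp.ne_iff.mp hc
      have h2 := DFunLike.congr_fun h i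
      simp only [Finsupp.add_apply, Finsupp.smul_apply, smul_eq_mul] at h2
      have h3 := hb i
      have h4 : p ^ e * 1 ≤ p ^ e * c i := Nat.mul_le_mul_left _ (Nat.pos_of_ne_zero hi)
      omega
    rw [if_neg h1, map_zero]
    split_ifs
    · rw [coeff_one, if_neg hc]
    · simp

/-- The box monomials of weight zero modulo `n` span a free direct summand of `R^{1/q}`. -/
theorem exists_surjective_boxCount (hpn : Nat.Coprime p n) :
    ∃ φ : FrobeniusRoot (weightSubalgebra k n t) p e →ₗ[weightSubalgebra k n t]
      (Fin (boxCount n t (p ^ e)) → weightSubalgebra k n t), Function.Surjective φ := by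
  classical
  let ι := {a : Fin d → Fin (p ^ e) // n ∣ ∑ i, (a i : ℕ) * t i}
  let B := weightSubalgebra k n t
  let root := rootEquiv B p e
  have hlt : ∀ (a : ι) i, boxExponent a.1 i < p ^ e := fun a i => (a.1 i).2
  let ψ : FrobeniusRoot B p e →ₗ[B] (ι → B) :=
    { toFun := fun x a => ⟨rootComponent p e (boxExponent a.1) (root.symm x).1,
        rootComponent_mem hpn (dvd_weight_boxExponent a) (root.symm x).2⟩
      map_add' := by
        intro x y
        funext a
        exact Subtype.ext (rootComponent_add _ _ _)
      map_smul' := by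
        intro r x
        funext a
        exact Subtype.ext (rootComponent_pow_mul _ (hlt a) _ _) }
  have hψ : ∀ a : ι, ψ (root (weightMonomial k _ (dvd_weight_boxExponent a))) = Pi.single a 1 := by
    intro a
    funext b
    apply Subtype.ext
    change rootComponent p e (boxExponent b.1) (monomial (boxExponent a.1) (1 : k)) = _
    rw [rootComponent_monomial _ _ (hlt a), Pi.single_apply]
    have : boxExponent b.1 = boxExponent a.1 ↔ b = a :=
      boxExponent_injective.eq_iff.trans Subtype.ext_iff.symm
    simp only [this]
    split_ifs <;> rfl
  have hsurj : Function.Surjective ψ := by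
    intro F
    refine ⟨∑ a, F a • root (weightMonomial k _ (dvd_weight_boxExponent a)), ?_⟩
    rw [map_sum]
    simp_rw [map_smul, hψ]
    funext b
    rw [Finset.sum_apply, Finset.sum_eq_single b]
    · simp
    · intro a _ hab
      simp [Pi.single_eq_of_ne hab.symm]
    · simp
  let E := LinearEquiv.funCongrLeft B B (Finite.equivFin ι).symm
  exact ⟨E.toLinearMap ∘ₗ ψ, E.surjective.comp hsurj⟩

end LowerBound

/-- Under the arithmetic form of smallness, the F-signature function of the monomial ring counts
lattice points in a box. -/
theorem FS_weightSubalgebra {n : ℕ} {t : Fin d → ℕ} {p : ℕ} [ExpChar k p] [PerfectRing k p]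
    (hn : 0 < n) (hpn : Nat.Coprime p n) (h : ∀ i, gJ n t (Finset.univ.erase i) = 1) (e : ℕ) :
    FS (weightSubalgebra k n t) p e = boxCount n t (p ^ e) :=
  IsGreatest.csSup_eq ⟨exists_surjective_boxCount hpn, fun _ ⟨φ, hφ⟩ =>
    le_boxCount_of_surjective hn (fun i => exists_weight_modEq hn i (h i)) φ hφ⟩

end CyclicQuotient

/-! ### The coefficients of the F-signature function -/

open CyclicQuotient

theorem theorem4p11 {k : Type*} [Field k] [IsAlgClosed k] (p : ℕ) [Fact p.Prime] [CharP k p]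
    (d n : ℕ) (hn : 0 < n) (hpn : ¬ p ∣ n)
    (G : Subgroup (GL (Fin d) k)) (hcard : Nat.card G = n)
    (hsmall : CyclicQuotient.IsSmall G)
    (ζ : k) (hζ : IsPrimitiveRoot ζ n) (t : Fin d → ℕ)
    (hG : CyclicQuotient.IsCyclicOfType G ζ t) :
    (∃! φ : Fin (d + 1) → ℕ → ℚ,
      CyclicQuotient.IsQuasiPolynomial
        (CyclicQuotient.FS (CyclicQuotient.invariants G) p) p d φ) ∧
    ∀ φ : Fin (d + 1) → ℕ → ℚ,
      CyclicQuotient.IsQuasiPolynomial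
        (CyclicQuotient.FS (CyclicQuotient.invariants G) p) p d φ →
      (∀ c : ℕ, 1 ≤ c → c < d →
        ((∀ i : Fin (d + 1), c ≤ (i : ℕ) → (i : ℕ) < d → ∀ e : ℕ, φ i e = 0) ↔
          ∀ J : Finset (Fin d), J.card = c → CyclicQuotient.gJ n t J = 1)) ∧
      (∀ l : Fin (d + 1), (l : ℕ) < d →
        (∀ i : Fin (d + 1), (l : ℕ) < (i : ℕ) → (i : ℕ) < d → ∀ e : ℕ, φ i e = 0) →
        (∃ e : ℕ, φ l e ≠ 0) →
        ∀ e : ℕ, φ l e =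
          ((CyclicQuotient.psi n t (p ^ e % n) l : ℚ)
            - (d.choose l : ℚ) * ((p ^ e % n : ℕ) : ℚ) ^ (d - (l : ℕ))) / n) := by
  have hp : p.Prime := Fact.out
  have hcop : Nat.Coprime p n := (Nat.Prime.coprime_iff_not_dvd hp).mpr hpn
  have hn' : (n : ℚ) ≠ 0 := by exact_mod_cast hn.ne'
  have hg := gJ_erase_eq_one hn hζ hcard hsmall hG
  obtain ⟨σ⟩ := nonempty_invariants_equiv hζ hG
  have hFS : FS (invariants G) p = fun e => boxCount n t (p ^ e) := by
    funext e
    rw [FS_congr p σ, FS_weightSubalgebra hn hcop hg]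
  have hquasi := isQuasiPolynomial_boxCount hn t hcop
  rw [← hFS] at hquasi
  refine ⟨⟨_, hquasi, fun φ h => h.unique hp.one_lt hquasi⟩, fun φ hφ => ?_⟩
  have hcoeff : ∀ (i : Fin (d + 1)) (e : ℕ), (i : ℕ) < d → φ i e =
      (shiftedPolynomial d ((p ^ e % n : ℕ) : ℚ) (psiDefect n t (p ^ e % n))).coeff i / n :=
    fun i e hi => by
      rw [hφ.unique hp.one_lt hquasi]
      exact coeff_boxPolynomial t _ _ hi
  -- for `d > 0` the set `J` of all indices contains the complement of a single index
  have htop : ∀ c, c < d → ∀ r, psiDefect n t r d = 0 := fun c hc r =>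
    psiDefect_eq_zero n t r d fun J hJ => by
      have h1 := gJ_dvd_of_subset n t (I := Finset.univ.erase ⟨c, hc⟩) (J := J) (by
        rw [Finset.card_eq_iff_eq_univ J |>.mp (by rw [hJ, Fintype.card_fin])]
        exact Finset.erase_subset _ _)
      rwa [hg, Nat.dvd_one] at h1
  -- the leading coefficient of the defect polynomial vanishes, so its coefficients from `c` on do
  -- as soon as those from `c` to `d - 1` do
  have hdefect : ∀ c e, (∀ i : Fin (d + 1), c ≤ (i : ℕ) → (i : ℕ) < d → φ i e = 0) → c < d →
      ∀ i, c ≤ i → i ≤ d → psiDefect n t (p ^ e % n) i = 0 := by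
    intro c e h hc
    refine (coeff_shiftedPolynomial_eq_zero_iff (r := ((p ^ e % n : ℕ) : ℚ))).mp fun i hci hid => ?_
    rcases hid.lt_or_eq with hid | rfl
    · have h1 := h ⟨i, by omega⟩ hci hid
      rw [hcoeff _ _ hid, div_eq_zero_iff] at h1
      exact h1.resolve_right hn'
    · rw [coeff_shiftedPolynomial le_rfl fun j h1 h2 => absurd h1 (not_lt.mpr h2)]
      exact htop c hc _
  refine ⟨fun c _ hcd => ⟨fun h J hJ => ?_, fun h i hci hid e => ?_⟩, fun l hl h _ e => ?_⟩
  · have h1 := hdefect c 0 (fun i h1 h2 => h i h1 h2 0) hcd c le_rfl hcd.le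
    rw [pow_zero] at h1
    exact gJ_eq_one_of_psiDefect_eq_zero hn t c h1 J hJ
  · rw [hcoeff i e hid, coeff_shiftedPolynomial_eq_zero_iff.mpr _ i hci hid.le, zero_div]
    refine fun j hcj _ => psiDefect_eq_zero n t _ j fun J hJ => ?_
    obtain ⟨I, hIJ, hI⟩ := Finset.exists_subset_card_eq (hcj.trans hJ.ge)
    have h1 := gJ_dvd_of_subset n t hIJ
    rwa [h I hI, Nat.dvd_one] at h1
  · rw [hcoeff l e hl, coeff_shiftedPolynomial hl.le fun i hli hid => ?_]
    · rfl
    · rcases hid.lt_or_eq with hid' | rfl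
      · exact hdefect (l + 1) e (fun j h1 h2 => h j h1 h2 e) (by omega) i hli hid
      · exact htop l hl _
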